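/- Let $n=n_1\cdots n_s$ and let $\mathcal D$ be either the set of separable states on $\mathbb C^{n_1}\otimes\cdots\otimes\mathbb C^{n_s}$ (convex combinations of tensor products of local density matrices) or the set of PPT states (density matrices all of whose partial transposes, with respect to arbitrary subsets of the parties, are positive semidefinite). A state is a positive semidefinite $n\times n$ matrix of trace one, and a state is called entangled if it is not in $\mathcal D$. For states $\rho,\sigma$ let $S(\rho\|\sigma)=\operatorname{Tr}(\rho\log\rho-\rho\log\sigma)$ if $\ker\sigma\subseteq\ker\rho$ (logarithms taken on the supports) and $S(\rho\|\sigma)=+\infty$ otherwise, and let $E_R(\rho)=\inf_{\sigma'\in\mathcal D}S(\rho\|\sigma')$. A state $\sigma\in\mathcal D$ is a closest separable (respectively closest PPT) state, CSS, of $\rho$ if $E_R(\rho)=S(\rho\|\sigma)$. For a state $\sigma$ with $\sigma=U\operatorname{diag}(s_1,\dots,s_n)U^\dagger$, $U$ unitary, let $P_\sigma$ be the orthogonal projection onto the range of $\sigma$, and put $$L_\sigma(\xi)=U\big(T\circ(U^\dagger\xi U)\big)U^\dagger,\qquad L_\sigma^{\ddagger}(\xi)=U\big(S\circ(U^\dagger\xi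 U)\big)U^\dagger,$$ where $\circ$ is the entrywise product, $T_{kl}=\frac{\log s_k-\log s_l}{s_k-s_l}$ and $S_{kl}=\frac{s_k-s_l}{\log s_k-\log s_l}$ if $s_k,s_l>0$ (read as $1/s_k$ and $s_k$ when $s_k=s_l$), and $T_{kl}=S_{kl}=0$ if $s_k=0$ or $s_l=0$. Thus $L_\sigma^{\ddagger}$ is the Moore–Penrose inverse of $L_\sigma$. Let $\sigma$ be a singular matrix in the boundary $\partial\mathcal D$ of $\mathcal D$ (relative to the affine span of $\mathcal D$), and let $\rho$ be an entangled state. Call a Hermitian matrix $\psi$ admissible if $\operatorname{Tr}\psi\sigma'\le\operatorname{Tr}\psi\sigma=1$ for all $\sigma'\in\mathcal D$, $\psi\mathbf x=\mathbf 0$ whenever $\sigma\mathbf x=\mathbf 0$, and $\psi\ne P_\sigma$. For every admissible $\psi$ there is a largest $x\le 1$ for which $(1-x)\sigma+xL_\sigma^{\ddagger}(\psi)$ is a state; denote it by $x_{\max}=x_{\max}(\psi)$. Then $0<x_{\max}\le1$. Moreover, $\sigma$ is a CSS of $\rho$ if and only if there are an admissible $\psi$ and a real $x$ with $0<x\le x_{\max}(\psi)$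 such that $$\rho=(1-x)\sigma+xL_\sigma^{\ddagger}(\psi).$$ -/

import Mathlib

open scoped Matrix ComplexOrder

namespace REE

section General

variable {m : Type*} [Fintype m] [DecidableEq m]

/-- A density matrix: positive semidefinite of trace one. -/
def IsState (ρ : Matrix m m ℂ) : Prop := ρ.PosSemidef ∧ ρ.trace = 1

/-- The pairing `Tr (X Y)` of Hermitian matrices, which is a real number. -/
def trPair (X Y : Matrix m m ℂ) : ℝ := (X * Y).trace.re

open Classical in
/-- The relative entropy `S(ρ‖σ) = Tr (ρ log ρ - ρ log σ)`, equal to `+∞` unless the kernel of `σ`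
is contained in the kernel of `ρ`. The logarithm is taken on the support (`Real.log 0 = 0`). -/
noncomputable def relEntropy (ρ σ : Matrix m m ℂ) : EReal :=
  if ∀ v : m → ℂ, σ *ᵥ v = 0 → ρ *ᵥ v = 0 then
    ((trPair ρ (cfc Real.log ρ) - trPair ρ (cfc Real.log σ) : ℝ) : EReal)
  else ⊤

/-- `E_R(ρ)`: the infimum of `S(ρ‖σ')` over `σ' ∈ D`. -/
noncomputable def relEntropyOfEntanglement (D : Set (Matrix m m ℂ)) (ρ : Matrix m m ℂ) : EReal :=
  ⨅ σ' ∈ D, relEntropy ρ σ'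

/-- `σ` is a closest state of `ρ` in `D`: it lies in `D` and attains the infimum. -/
def IsClosestState (D : Set (Matrix m m ℂ)) (ρ σ : Matrix m m ℂ) : Prop :=
  σ ∈ D ∧ relEntropyOfEntanglement D ρ = relEntropy ρ σ

/-- The divided difference of `log` at two positive numbers, extended by zero. -/
noncomputable def kerT (a b : ℝ) : ℝ :=
  if a = 0 ∨ b = 0 then 0
  else if a = b then 1 / a
  else (Real.log a - Real.log b) / (a - b)

/-- The reciprocal of the divided difference of `log` at two positive numbers,
extended by zero. -/
noncomputable def kerS (a b : ℝ) : ℝ :=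
  if a = 0 ∨ b = 0 then 0
  else if a = b then a
  else (a - b) / (Real.log a - Real.log b)

/-- In an orthonormal eigenbasis of `σ`, with eigenvalues `s k`, take the entrywise product of `ξ`
with the matrix `K (s k) (s l)`. -/
noncomputable def eigHadamard {σ : Matrix m m ℂ} (hσ : σ.IsHermitian) (K : ℝ → ℝ → ℝ)
    (ξ : Matrix m m ℂ) : Matrix m m ℂ :=
  (hσ.eigenvectorUnitary : Matrix m m ℂ) *
    (Matrix.of (fun k l => ((K (hσ.eigenvalues k) (hσ.eigenvalues l) : ℝ) : ℂ)) ⊙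
      (star (hσ.eigenvectorUnitary : Matrix m m ℂ) * ξ * (hσ.eigenvectorUnitary : Matrix m m ℂ))) *
    star (hσ.eigenvectorUnitary : Matrix m m ℂ)

/-- The operator `L_σ`. -/
noncomputable def logDeriv {σ : Matrix m m ℂ} (hσ : σ.IsHermitian) (ξ : Matrix m m ℂ) :
    Matrix m m ℂ :=
  eigHadamard hσ kerT ξ

/-- The Moore–Penrose inverse `L_σ^‡` of `L_σ`. -/
noncomputable def logDerivPinv {σ : Matrix m m ℂ} (hσ : σ.IsHermitian) (ξ : Matrix m m ℂ) :
    Matrix m m ℂ :=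
  eigHadamard hσ kerS ξ

/-- The orthogonal projection `P_σ` onto the support (the range) of a Hermitian matrix `σ`. -/
noncomputable def suppProj (σ : Matrix m m ℂ) : Matrix m m ℂ :=
  cfc (fun x : ℝ => if x = 0 then 0 else 1) σ

/-- `ψ` represents a supporting hyperplane of `D` at `σ`, vanishes off the support of `σ`, and
differs from `P_σ`. -/
structure IsSupporting (D : Set (Matrix m m ℂ)) (σ ψ : Matrix m m ℂ) : Prop where
  isHermitian : ψ.IsHermitian
  pair_le : ∀ σ' ∈ D, trPair ψ σ' ≤ trPair ψ σ
  pair_self : trPair ψ σ = 1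
  vanish : ∀ v : m → ℂ, σ *ᵥ v = 0 → ψ *ᵥ v = 0
  ne_suppProj : ψ ≠ suppProj σ

/-- The matrix `ρ(x, σ) = (1 - x) σ + x L_σ^‡(ψ)`. -/
noncomputable def segState {σ : Matrix m m ℂ} (hσ : σ.IsHermitian) (ψ : Matrix m m ℂ) (x : ℝ) :
    Matrix m m ℂ :=
  (1 - x) • σ + x • logDerivPinv hσ ψ

/-- `x_max` is the largest `x ≤ 1` for which `ρ(x, σ)` is a state. -/
def IsXMax {σ : Matrix m m ℂ} (hσ : σ.IsHermitian) (ψ : Matrix m m ℂ) (xmax : ℝ) : Prop :=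
  IsGreatest {x : ℝ | x ≤ 1 ∧ IsState (segState hσ ψ x)} xmax

/-! Consistency of `L_σ`, `L_σ^‡` and `P_σ`. -/

lemma kerT_mul_kerS {a b : ℝ} (ha : 0 ≤ a) (hb : 0 ≤ b) :
    kerT a b * kerS a b = (if a = 0 then 0 else 1) * (if b = 0 then 0 else 1) := by
  unfold kerT kerS
  by_cases h1 : a = 0
  · simp [h1]
  by_cases h2 : b = 0
  · simp [h2]
  by_cases h3 : a = b
  · subst h3; simp [h1]
  have h4 : a - b ≠ 0 := sub_ne_zero.2 h3
  have h5 : Real.log a - Real.log b ≠ 0 := fun h =>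
    h3 (Real.log_injOn_pos (lt_of_le_of_ne ha (Ne.symm h1)) (lt_of_le_of_ne hb (Ne.symm h2))
      (sub_eq_zero.1 h))
  simp only [h1, h2, h3, or_self, if_false, mul_one]
  field_simp

lemma eigHadamard_comp {σ : Matrix m m ℂ} (hσ : σ.IsHermitian) (K K' : ℝ → ℝ → ℝ)
    (ξ : Matrix m m ℂ) :
    eigHadamard hσ K (eigHadamard hσ K' ξ) = eigHadamard hσ (fun a b => K a b * K' a b) ξ := by
  have hU : star (hσ.eigenvectorUnitary : Matrix m m ℂ) *
      (hσ.eigenvectorUnitary : Matrix m m ℂ) = 1 :=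
    Unitary.coe_star_mul_self hσ.eigenvectorUnitary
  have key : ∀ X : Matrix m m ℂ, star (hσ.eigenvectorUnitary : Matrix m m ℂ) *
      ((hσ.eigenvectorUnitary : Matrix m m ℂ) * X *
        star (hσ.eigenvectorUnitary : Matrix m m ℂ)) *
        (hσ.eigenvectorUnitary : Matrix m m ℂ) = X := by
    intro X
    rw [mul_assoc, mul_assoc, hU, mul_one, ← mul_assoc, hU, one_mul]
  unfold eigHadamard
  rw [key]
  congr 2
  ext k l
  simp [mul_assoc]

lemma suppProj_sandwich {σ : Matrix m m ℂ} (hσ : σ.IsHermitian) (ξ : Matrix m m ℂ) :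
    suppProj σ * ξ * suppProj σ =
      eigHadamard hσ (fun a b => (if a = 0 then 0 else 1) * (if b = 0 then 0 else 1)) ξ := by
  have hP : suppProj σ = (hσ.eigenvectorUnitary : Matrix m m ℂ) *
      Matrix.diagonal (fun k => ((if hσ.eigenvalues k = 0 then 0 else 1 : ℝ) : ℂ)) *
      star (hσ.eigenvectorUnitary : Matrix m m ℂ) := by
    unfold suppProj
    rw [hσ.cfc_eq, Matrix.IsHermitian.cfc, Unitary.conjStarAlgAut_apply]
    rfl
  rw [hP]
  unfold eigHadamard
  simp only [mul_assoc]
  congr 1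
  simp only [← mul_assoc]
  congr 1
  simp only [mul_assoc]
  rw [← mul_assoc (star _) ξ, ← mul_assoc (star (hσ.eigenvectorUnitary : Matrix m m ℂ) * ξ),
    ← mul_assoc (star (hσ.eigenvectorUnitary : Matrix m m ℂ)) ξ]
  ext k l
  simp only [Matrix.diagonal_mul, Matrix.mul_diagonal, Matrix.hadamard_apply, Matrix.of_apply]
  push_cast
  ring

/-- `L_σ L_σ^‡` is the compression to the support of `σ`. -/
lemma logDeriv_logDerivPinv {σ : Matrix m m ℂ} (hσ : σ.PosSemidef) (ξ : Matrix m m ℂ) :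
    logDeriv hσ.isHermitian (logDerivPinv hσ.isHermitian ξ) = suppProj σ * ξ * suppProj σ := by
  rw [suppProj_sandwich hσ.isHermitian, logDeriv, logDerivPinv, eigHadamard_comp]
  unfold eigHadamard
  simp only [kerT_mul_kerS (hσ.eigenvalues_nonneg _) (hσ.eigenvalues_nonneg _)]

/-- `L_σ^‡ L_σ` is the compression to the support of `σ`. -/
lemma logDerivPinv_logDeriv {σ : Matrix m m ℂ} (hσ : σ.PosSemidef) (ξ : Matrix m m ℂ) :
    logDerivPinv hσ.isHermitian (logDeriv hσ.isHermitian ξ) = suppProj σ * ξ * suppProj σ := by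
  rw [← logDeriv_logDerivPinv hσ, logDeriv, logDerivPinv, logDeriv, logDerivPinv,
    eigHadamard_comp, eigHadamard_comp]
  simp only [mul_comm]

end General

section Multipartite

variable {s : ℕ} (d : Fin s → ℕ)

/-- Basis labels of `ℂ^{d 0} ⊗ ⋯ ⊗ ℂ^{d (s-1)}`. -/
abbrev Idx : Type := (i : Fin s) → Fin (d i)

/-- The tensor (Kronecker) product of local matrices. -/
def tensor (A : (i : Fin s) → Matrix (Fin (d i)) (Fin (d i)) ℂ) : Matrix (Idx d) (Idx d) ℂ :=
  Matrix.of fun a b => ∏ i, A i (a i) (b i)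

/-- The separable states: convex combinations of tensor products of local states. -/
def separableStates : Set (Matrix (Idx d) (Idx d) ℂ) :=
  convexHull ℝ {ρ | ∃ A : (i : Fin s) → Matrix (Fin (d i)) (Fin (d i)) ℂ,
    (∀ i, IsState (A i)) ∧ ρ = tensor d A}

/-- The partial transpose with respect to the parties in `S`. -/
def partialTranspose (S : Finset (Fin s)) (ρ : Matrix (Idx d) (Idx d) ℂ) :
    Matrix (Idx d) (Idx d) ℂ :=
  Matrix.of fun a b =>
    ρ (fun i => if i ∈ S then b i else a i) (fun i => if i ∈ S then a i else b i)

/-- The PPT states: all partial transposes are positive semidefinite. -/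
def pptStates : Set (Matrix (Idx d) (Idx d) ℂ) :=
  {ρ | IsState ρ ∧ ∀ S : Finset (Fin s), (partialTranspose d S ρ).PosSemidef}

end Multipartite

end REE

/-!
For `R ≥ 0` whose kernel contains that of `A ≥ 0`, the logarithm and its derivative have the
resolvent representations

* `Tr R log A = ∫₀^∞ Tr R ((1 + u)⁻¹ - (A + u)⁻¹) du` (`hasIntegralIoi_log`),
* `Tr L_A(R) X = ∫₀^∞ Tr ((A + u)⁻¹ R (A + u)⁻¹ X) du` (`hasIntegralIoi_logDeriv`).

Integrating the inequality `B⁻¹ ≥ A⁻¹ - A⁻¹ (B - A) A⁻¹` gives the tangent inequality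
`Tr R log B - Tr R log A ≤ Tr L_A(R) (B - A)` (`trPair_log_sub_le`), valid also for singular `A`
and `B`. Both directions of the criterion follow from it, and the only fact about `D` used besides
closedness is that it is a convex set of states with an element of full rank
(`isClosestState_iff`).

* If `ρ = (1 - x) σ + x L_σ^‡(ψ)`, then `L_σ(ρ) = (1 - x) P_σ + x ψ` pairs with every state of `D`
  to at most `1 = Tr L_σ(ρ) σ`, and the tangent inequality at `σ` shows that `σ` is closest.
* If `σ` is closest and `τ ∈ D`, the tangent inequality at `σ_t = (1 - t) σ + t τ`, evaluated at
  `σ`, gives `Tr L_{σ_t}(ρ) τ ≤ 1`. The operator norm of `L_{σ_t}` may blow up as `t → 0`, but the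
  integrand above is nonnegative, so Fatou's lemma yields `Tr L_σ(ρ) τ ≤ 1`
  (`IsClosestState.trPair_logDeriv_le`). Hence `ψ = L_σ(ρ)` is admissible, and
  `L_σ^‡(L_σ(ρ)) = ρ`, so that `x = x_max = 1` works; `ψ = P_σ` would mean `ρ = σ`.

The number `x_max` exists because states form a closed set, and it is positive because
`L_σ^‡(ψ)` is Hermitian, supported on the support of `σ`, and of trace `Tr ψ σ = 1`
(`exists_isXMax`). A boundary point of `D` lies in `D` because `D` is closed; for separable states
this is Carathéodory's theorem (`isCompact_convexHull`).
-/

open MeasureTheory Filter Topology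

namespace REE

/-! ### Traces and functional calculus in an eigenbasis -/

section Spectral

variable {m : Type*} [Fintype m]

lemma trPair_comm (X Y : Matrix m m ℂ) : trPair X Y = trPair Y X := by
  rw [trPair, Matrix.trace_mul_comm, trPair]

lemma trPair_add_left (X Y Z : Matrix m m ℂ) : trPair (X + Y) Z = trPair X Z + trPair Y Z := by
  simp [trPair, add_mul]

lemma trPair_add_right (X Y Z : Matrix m m ℂ) : trPair X (Y + Z) = trPair X Y + trPair X Z := by
  simp [trPair, mul_add]

lemma trPair_sub_right (X Y Z : Matrix m m ℂ) : trPair X (Y - Z) = trPair X Y - trPair X Z := by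
  simp [trPair, mul_sub]

lemma trPair_smul_left (c : ℝ) (X Y : Matrix m m ℂ) : trPair (c • X) Y = c * trPair X Y := by
  simp [trPair]

lemma trPair_smul_right (c : ℝ) (X Y : Matrix m m ℂ) : trPair X (c • Y) = c * trPair X Y := by
  simp [trPair]

open scoped MatrixOrder in
lemma trPair_nonneg {X Y : Matrix m m ℂ} (hX : X.PosSemidef) (hY : Y.PosSemidef) :
    0 ≤ trPair X Y := by
  classical
  obtain ⟨B, rfl⟩ := CStarAlgebra.nonneg_iff_eq_star_mul_self.mp hY.nonneg
  rw [trPair, ← mul_assoc, Matrix.trace_mul_comm, ← mul_assoc]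
  exact (Complex.le_def.1 (hX.mul_mul_conjTranspose_same B).trace_nonneg).1

lemma continuous_trPair_left (Y : Matrix m m ℂ) : Continuous fun X => trPair X Y := by
  unfold trPair
  fun_prop

lemma trPair_eq_sum (X Y : Matrix m m ℂ) :
    trPair X Y = ∑ k, ∑ l, (X k l * Y l k).re := by
  simp [trPair, Matrix.trace, Matrix.mul_apply, -Complex.mul_re]

variable [DecidableEq m]

lemma trPair_one_right (X : Matrix m m ℂ) : trPair X 1 = X.trace.re := by
  simp [trPair]

/-- The matrix of `X` in the eigenbasis of `A`. -/
noncomputable def eigRepr {A : Matrix m m ℂ} (hA : A.IsHermitian) (X : Matrix m m ℂ) :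
    Matrix m m ℂ :=
  star (hA.eigenvectorUnitary : Matrix m m ℂ) * X * (hA.eigenvectorUnitary : Matrix m m ℂ)

variable {A : Matrix m m ℂ}

lemma eigHadamard_eq (hA : A.IsHermitian) (K : ℝ → ℝ → ℝ) (X : Matrix m m ℂ) :
    eigHadamard hA K X = (hA.eigenvectorUnitary : Matrix m m ℂ) *
      (Matrix.of (fun k l => ((K (hA.eigenvalues k) (hA.eigenvalues l) : ℝ) : ℂ)) ⊙ eigRepr hA X) *
      star (hA.eigenvectorUnitary : Matrix m m ℂ) := rfl

lemma star_eigenvectorUnitary_mul (hA : A.IsHermitian) :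
    star (hA.eigenvectorUnitary : Matrix m m ℂ) * (hA.eigenvectorUnitary : Matrix m m ℂ) = 1 :=
  Unitary.coe_star_mul_self hA.eigenvectorUnitary

lemma eigenvectorUnitary_mul_star (hA : A.IsHermitian) :
    (hA.eigenvectorUnitary : Matrix m m ℂ) * star (hA.eigenvectorUnitary : Matrix m m ℂ) = 1 :=
  Unitary.coe_mul_star_self hA.eigenvectorUnitary

lemma eq_conj_eigRepr (hA : A.IsHermitian) (X : Matrix m m ℂ) :
    X = (hA.eigenvectorUnitary : Matrix m m ℂ) * eigRepr hA X *
      star (hA.eigenvectorUnitary : Matrix m m ℂ) := by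
  simp only [eigRepr, mul_assoc, eigenvectorUnitary_mul_star, mul_one]
  rw [← mul_assoc, eigenvectorUnitary_mul_star, one_mul]

lemma eigRepr_conj (hA : A.IsHermitian) (X : Matrix m m ℂ) :
    eigRepr hA ((hA.eigenvectorUnitary : Matrix m m ℂ) * X *
      star (hA.eigenvectorUnitary : Matrix m m ℂ)) = X := by
  simp only [eigRepr, mul_assoc, star_eigenvectorUnitary_mul, mul_one]
  rw [← mul_assoc, star_eigenvectorUnitary_mul, one_mul]

lemma eigRepr_mul (hA : A.IsHermitian) (X Y : Matrix m m ℂ) :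
    eigRepr hA (X * Y) = eigRepr hA X * eigRepr hA Y := by
  conv_lhs => rw [eq_conj_eigRepr hA X]
  simp only [eigRepr, mul_assoc]
  rw [← mul_assoc (star _) (hA.eigenvectorUnitary : Matrix m m ℂ), star_eigenvectorUnitary_mul,
    one_mul]

lemma eigRepr_injective (hA : A.IsHermitian) : Function.Injective (eigRepr hA) := by
  intro X Y h
  rw [eq_conj_eigRepr hA X, h, ← eq_conj_eigRepr hA Y]

lemma trace_eigRepr (hA : A.IsHermitian) (X : Matrix m m ℂ) :
    (eigRepr hA X).trace = X.trace := by
  rw [eigRepr, Matrix.trace_mul_comm, ← mul_assoc, eigenvectorUnitary_mul_star, one_mul]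

lemma eigRepr_eigHadamard (hA : A.IsHermitian) (K : ℝ → ℝ → ℝ) (X : Matrix m m ℂ) (k l : m) :
    eigRepr hA (eigHadamard hA K X) k l =
      (K (hA.eigenvalues k) (hA.eigenvalues l) : ℝ) * eigRepr hA X k l := by
  rw [eigHadamard_eq, eigRepr_conj]
  rfl

lemma cfc_eq_conj (hA : A.IsHermitian) (f : ℝ → ℝ) :
    cfc f A = (hA.eigenvectorUnitary : Matrix m m ℂ) *
      Matrix.diagonal (fun k => ((f (hA.eigenvalues k) : ℝ) : ℂ)) *
      star (hA.eigenvectorUnitary : Matrix m m ℂ) := by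
  rw [hA.cfc_eq, Matrix.IsHermitian.cfc, Unitary.conjStarAlgAut_apply]
  rfl

lemma eigRepr_cfc (hA : A.IsHermitian) (f : ℝ → ℝ) :
    eigRepr hA (cfc f A) = Matrix.diagonal (fun k => ((f (hA.eigenvalues k) : ℝ) : ℂ)) := by
  rw [cfc_eq_conj hA, eigRepr_conj]

lemma eigRepr_self (hA : A.IsHermitian) :
    eigRepr hA A = Matrix.diagonal (fun k => ((hA.eigenvalues k : ℝ) : ℂ)) := by
  have h := eigRepr_cfc hA (fun x => x)
  rwa [cfc_id' ℝ A (ha := hA.isSelfAdjoint)] at h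

lemma isHermitian_eigRepr (hA : A.IsHermitian) {X : Matrix m m ℂ} (hX : X.IsHermitian) :
    (eigRepr hA X).IsHermitian := by
  simp only [eigRepr, Matrix.star_eq_conjTranspose]
  exact Matrix.isHermitian_conjTranspose_mul_mul _ hX

lemma isHermitian_eigHadamard (hA : A.IsHermitian) {K : ℝ → ℝ → ℝ} (hK : ∀ a b, K a b = K b a)
    {X : Matrix m m ℂ} (hX : X.IsHermitian) : (eigHadamard hA K X).IsHermitian := by
  rw [eigHadamard_eq, Matrix.star_eq_conjTranspose]
  refine Matrix.isHermitian_mul_mul_conjTranspose _ ?_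
  ext k l
  have h := (isHermitian_eigRepr hA hX).apply k l
  simp only [Matrix.conjTranspose_apply, Matrix.hadamard_apply, Matrix.of_apply, star_mul', h]
  simp [hK (hA.eigenvalues l)]

lemma trPair_eigRepr (hA : A.IsHermitian) (X Y : Matrix m m ℂ) :
    trPair (eigRepr hA X) (eigRepr hA Y) = trPair X Y := by
  rw [trPair, ← eigRepr_mul, trace_eigRepr, trPair]

lemma trPair_eigHadamard (hA : A.IsHermitian) (K : ℝ → ℝ → ℝ) (X Y : Matrix m m ℂ) :
    trPair (eigHadamard hA K X) Y = ∑ k, ∑ l,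
      K (hA.eigenvalues k) (hA.eigenvalues l) * (eigRepr hA X k l * eigRepr hA Y l k).re := by
  rw [← trPair_eigRepr hA, trPair_eq_sum]
  simp only [eigRepr_eigHadamard, mul_assoc, Complex.re_ofReal_mul]

lemma trPair_cfc (hA : A.IsHermitian) (f : ℝ → ℝ) (X : Matrix m m ℂ) :
    trPair X (cfc f A) = ∑ k, f (hA.eigenvalues k) * (eigRepr hA X k k).re := by
  rw [← trPair_eigRepr hA, eigRepr_cfc, trPair_eq_sum]
  refine Finset.sum_congr rfl fun k _ => ?_
  rw [Finset.sum_eq_single k]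
  · rw [Matrix.diagonal_apply_eq, mul_comm, Complex.re_ofReal_mul]
  · intro l _ hl
    simp [Matrix.diagonal_apply_ne _ hl]
  · simp

lemma cfc_mul_mul_cfc (hA : A.IsHermitian) (f g : ℝ → ℝ) (X : Matrix m m ℂ) :
    cfc f A * X * cfc g A = eigHadamard hA (fun a b => f a * g b) X := by
  apply eigRepr_injective hA
  ext k l
  rw [eigRepr_eigHadamard, eigRepr_mul, eigRepr_mul, eigRepr_cfc, eigRepr_cfc,
    Matrix.mul_diagonal, Matrix.diagonal_mul]
  push_cast
  ring

/-- If the kernel of `A` is contained in that of `X`, then the columns of `X` (in an eigenbasis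
of `A`) at zero eigenvalues vanish. -/
lemma eigRepr_eq_zero_right (hA : A.IsHermitian) {X : Matrix m m ℂ}
    (hker : ∀ v : m → ℂ, A *ᵥ v = 0 → X *ᵥ v = 0) {l : m} (hl : hA.eigenvalues l = 0) (k : m) :
    eigRepr hA X k l = 0 := by
  have h : X *ᵥ (hA.eigenvectorBasis l : m → ℂ) = 0 := by
    apply hker
    rw [hA.mulVec_eigenvectorBasis, hl, zero_smul]
  rw [← hA.eigenvectorUnitary_mulVec, Matrix.mulVec_mulVec] at h
  have h2 : eigRepr hA X *ᵥ Pi.single l 1 = 0 := by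
    rw [eigRepr, mul_assoc, ← Matrix.mulVec_mulVec, h, Matrix.mulVec_zero]
  simpa using congrFun h2 k

lemma eigRepr_eq_zero_left (hA : A.IsHermitian) {X : Matrix m m ℂ} (hX : X.IsHermitian)
    (hker : ∀ v : m → ℂ, A *ᵥ v = 0 → X *ᵥ v = 0) {k : m} (hk : hA.eigenvalues k = 0) (l : m) :
    eigRepr hA X k l = 0 := by
  rw [← (isHermitian_eigRepr hA hX).apply, eigRepr_eq_zero_right hA hker hk, star_zero]

/-- `eigHadamard` preserves the kernel condition when its symbol vanishes at zero. -/
lemma eigHadamard_mulVec_eq_zero (hA : A.IsHermitian) {K : ℝ → ℝ → ℝ} (hK : ∀ a, K a 0 = 0)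
    (X : Matrix m m ℂ) (v : m → ℂ) (hv : A *ᵥ v = 0) : eigHadamard hA K X *ᵥ v = 0 := by
  have h1 : eigRepr hA A *ᵥ (star (hA.eigenvectorUnitary : Matrix m m ℂ) *ᵥ v) = 0 := by
    rw [eigRepr, Matrix.mulVec_mulVec, mul_assoc, eigenvectorUnitary_mul_star, mul_one,
      ← Matrix.mulVec_mulVec, hv, Matrix.mulVec_zero]
  rw [eigRepr_self] at h1
  rw [eigHadamard_eq, mul_assoc, ← Matrix.mulVec_mulVec, ← Matrix.mulVec_mulVec]
  refine (congrArg _ ?_).trans (Matrix.mulVec_zero _)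
  ext k
  rw [Matrix.mulVec, dotProduct]
  refine Finset.sum_eq_zero fun l _ => ?_
  have h2 := congrFun h1 l
  rw [Matrix.mulVec_diagonal, Pi.zero_apply, mul_eq_zero] at h2
  rcases h2 with h2 | h2
  · rw [Complex.ofReal_eq_zero] at h2
    simp [h2, hK]
  · rw [h2, mul_zero]

/-- The resolvent of `-A` at `u` by functional calculus. -/
lemma inv_add_smul_one_eq_cfc (hA : A.PosSemidef) {u : ℝ} (hu : 0 < u) :
    (A + u • (1 : Matrix m m ℂ))⁻¹ = cfc (fun a : ℝ => (a + u)⁻¹) A := by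
  apply Matrix.inv_eq_right_inv
  apply eigRepr_injective hA.isHermitian
  have h1 : eigRepr hA.isHermitian 1 = 1 := by
    rw [eigRepr, mul_one, star_eigenvectorUnitary_mul]
  have h2 : eigRepr hA.isHermitian (A + u • (1 : Matrix m m ℂ)) =
      Matrix.diagonal (fun k => ((hA.isHermitian.eigenvalues k + u : ℝ) : ℂ)) := by
    rw [eigRepr, mul_add, add_mul, ← eigRepr, eigRepr_self, mul_smul_comm, smul_mul_assoc,
      ← eigRepr, h1, ← Matrix.diagonal_one, ← Matrix.diagonal_smul, Matrix.diagonal_add]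
    congr 1
    ext k
    simp
  rw [eigRepr_mul, h2, eigRepr_cfc, h1, Matrix.diagonal_mul_diagonal, ← Matrix.diagonal_one]
  congr 1
  ext k
  have h3 : hA.isHermitian.eigenvalues k + u ≠ 0 := by
    have := hA.eigenvalues_nonneg k
    positivity
  rw [← Complex.ofReal_mul, mul_inv_cancel₀ h3, Complex.ofReal_one]

lemma posDef_add_smul_one {n : Type*} [DecidableEq n] {A : Matrix n n ℂ} (hA : A.PosSemidef)
    {u : ℝ} (hu : 0 < u) : (A + u • (1 : Matrix n n ℂ)).PosDef :=
  Matrix.PosDef.posSemidef_add hA (Matrix.PosDef.one.smul hu)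

end Spectral

/-! ### Integral representations and the tangent inequality for the logarithm -/

section Integral

lemma kerT_self {a : ℝ} (ha : 0 < a) : kerT a a = a⁻¹ := by
  simp [kerT, ha.ne']

lemma kerT_of_ne {a b : ℝ} (ha : 0 < a) (hb : 0 < b) (h : a ≠ b) :
    kerT a b = (Real.log a - Real.log b) / (a - b) := by
  simp [kerT, ha.ne', hb.ne', h]

lemma kerT_comm (a b : ℝ) : kerT a b = kerT b a := by
  unfold kerT
  by_cases h : a = b
  · rw [h]
  · rw [if_neg h, if_neg (Ne.symm h), ← neg_sub (Real.log b), ← neg_sub b, neg_div_neg_eq]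
    simp only [or_comm]

lemma kerS_comm (a b : ℝ) : kerS a b = kerS b a := by
  unfold kerS
  by_cases h : a = b
  · rw [h]
  · rw [if_neg h, if_neg (Ne.symm h), ← neg_sub (Real.log b), ← neg_sub b, neg_div_neg_eq]
    simp only [or_comm]

lemma kerT_zero_right (a : ℝ) : kerT a 0 = 0 := by simp [kerT]

lemma kerS_zero_right (a : ℝ) : kerS a 0 = 0 := by simp [kerS]

lemma sub_one_mul_kerT {a : ℝ} (ha : 0 < a) : (a - 1) * kerT 1 a = Real.log a := by
  rcases eq_or_ne 1 a with rfl | h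
  · simp
  · rw [kerT_of_ne one_pos ha h, Real.log_one]
    have h1 : 1 - a ≠ 0 := sub_ne_zero.2 h
    field_simp
    ring

/-- A function on `(0, ∞)` is integrable with a given integral. -/
def HasIntegralIoi (f : ℝ → ℝ) (v : ℝ) : Prop :=
  IntegrableOn f (Set.Ioi 0) ∧ ∫ u in Set.Ioi (0 : ℝ), f u = v

lemma HasIntegralIoi.congr {f g : ℝ → ℝ} {v : ℝ} (hf : HasIntegralIoi f v)
    (h : ∀ u, 0 < u → f u = g u) : HasIntegralIoi g v := by
  refine ⟨hf.1.congr_fun (fun u hu => h u hu) measurableSet_Ioi, ?_⟩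
  rw [← hf.2]
  exact (setIntegral_congr_fun measurableSet_Ioi fun u hu => h u hu).symm

lemma HasIntegralIoi.const_mul {f : ℝ → ℝ} {v : ℝ} (hf : HasIntegralIoi f v) (c : ℝ) :
    HasIntegralIoi (fun u => c * f u) (c * v) :=
  ⟨hf.1.const_mul c, by rw [integral_const_mul, hf.2]⟩

lemma HasIntegralIoi.sub {f g : ℝ → ℝ} {v w : ℝ} (hf : HasIntegralIoi f v)
    (hg : HasIntegralIoi g w) : HasIntegralIoi (fun u => f u - g u) (v - w) :=
  ⟨hf.1.sub hg.1, by rw [integral_sub hf.1 hg.1, hf.2, hg.2]⟩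

lemma hasIntegralIoi_zero : HasIntegralIoi (fun _ => 0) 0 :=
  ⟨integrableOn_zero, by simp⟩

lemma hasIntegralIoi_sum {ι : Type*} (s : Finset ι) {f : ι → ℝ → ℝ} {v : ι → ℝ}
    (h : ∀ i ∈ s, HasIntegralIoi (f i) (v i)) :
    HasIntegralIoi (fun u => ∑ i ∈ s, f i u) (∑ i ∈ s, v i) := by
  refine ⟨integrable_finsetSum s fun i hi => (h i hi).1, ?_⟩
  rw [integral_finsetSum s fun i hi => (h i hi).1]
  exact Finset.sum_congr rfl fun i hi => (h i hi).2

lemma HasIntegralIoi.mono {f g : ℝ → ℝ} {v w : ℝ} (hf : HasIntegralIoi f v)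
    (hg : HasIntegralIoi g w) (h : ∀ u, 0 < u → f u ≤ g u) : v ≤ w := by
  rw [← hf.2, ← hg.2]
  exact setIntegral_mono_on hf.1 hg.1 measurableSet_Ioi h

/-- The divided difference of the logarithm as an integral of products of scalar resolvents. -/
lemma hasIntegralIoi_kerT {a b : ℝ} (ha : 0 < a) (hb : 0 < b) :
    HasIntegralIoi (fun u => (a + u)⁻¹ * (b + u)⁻¹) (kerT a b) := by
  have hpos : ∀ u ∈ Set.Ioi (0 : ℝ), 0 ≤ (a + u)⁻¹ * (b + u)⁻¹ := by
    intro u hu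
    have : (0 : ℝ) < u := hu
    positivity
  suffices ∃ g : ℝ → ℝ, (∀ x ∈ Set.Ici (0 : ℝ), HasDerivAt g ((a + x)⁻¹ * (b + x)⁻¹) x) ∧
      Tendsto g atTop (𝓝 0) ∧ 0 - g 0 = kerT a b by
    obtain ⟨g, hg, hlim, hv⟩ := this
    exact ⟨integrableOn_Ioi_deriv_of_nonneg' hg hpos hlim,
      (integral_Ioi_of_hasDerivAt_of_nonneg' hg hpos hlim).trans hv⟩
  rcases eq_or_ne a b with rfl | hab
  · refine ⟨fun u => -(a + u)⁻¹, fun x hx => ?_, ?_, ?_⟩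
    · have hx : (0 : ℝ) ≤ x := hx
      have h1 : a + x ≠ 0 := by positivity
      convert! (((hasDerivAt_id x).const_add a).inv h1).neg using 1
      simp only [id]
      field_simp
    · rw [← neg_zero]
      exact (tendsto_inv_atTop_zero.comp (tendsto_atTop_add_const_left _ a tendsto_id)).neg
    · rw [kerT_self ha]
      simp
  · have hba : b - a ≠ 0 := sub_ne_zero.2 hab.symm
    refine ⟨fun u => (Real.log (a + u) - Real.log (b + u)) / (b - a), fun x hx => ?_, ?_, ?_⟩
    · have hx : (0 : ℝ) ≤ x := hx
      have h1 : a + x ≠ 0 := by positivity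
      have h2 : b + x ≠ 0 := by positivity
      convert! ((((hasDerivAt_id x).const_add a).log h1).sub
        (((hasDerivAt_id x).const_add b).log h2)).div_const (b - a) using 1
      simp only [id]
      field_simp
      ring
    · have h1 : Tendsto (fun u : ℝ => 1 + (a - b) * (b + u)⁻¹) atTop (𝓝 (1 + (a - b) * 0)) :=
        ((tendsto_inv_atTop_zero.comp
          (tendsto_atTop_add_const_left _ b tendsto_id)).const_mul _).const_add _
      rw [mul_zero, add_zero] at h1
      have h2 := ((Real.continuousAt_log one_ne_zero).tendsto.comp h1).div_const (b - a)
      rw [Real.log_one, zero_div] at h2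
      refine h2.congr' ?_
      filter_upwards [eventually_gt_atTop 0] with u hu
      have h3 : a + u ≠ 0 := by positivity
      have h4 : b + u ≠ 0 := by positivity
      rw [Function.comp, ← Real.log_div h3 h4]
      congr 2
      field_simp
      ring
    · rw [kerT_of_ne ha hb hab, ← neg_sub b a, div_neg]
      simp

variable {m : Type*} [Fintype m] [DecidableEq m]

/-- `L_A(R) = ∫ (A + u)⁻¹ R (A + u)⁻¹ du`, tested against a matrix. -/
lemma hasIntegralIoi_logDeriv {A R : Matrix m m ℂ} (hA : A.PosSemidef) (hR : R.IsHermitian)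
    (hker : ∀ v : m → ℂ, A *ᵥ v = 0 → R *ᵥ v = 0) (X : Matrix m m ℂ) :
    HasIntegralIoi (fun u => trPair ((A + u • (1 : Matrix m m ℂ))⁻¹ * R *
      (A + u • (1 : Matrix m m ℂ))⁻¹) X) (trPair (logDeriv hA.isHermitian R) X) := by
  have h : HasIntegralIoi (fun u => ∑ k, ∑ l, (eigRepr hA.isHermitian R k l *
      eigRepr hA.isHermitian X l k).re * ((hA.isHermitian.eigenvalues k + u)⁻¹ *
      (hA.isHermitian.eigenvalues l + u)⁻¹)) (∑ k, ∑ l, (eigRepr hA.isHermitian R k l *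
      eigRepr hA.isHermitian X l k).re *
      kerT (hA.isHermitian.eigenvalues k) (hA.isHermitian.eigenvalues l)) := by
    refine hasIntegralIoi_sum _ fun k _ => hasIntegralIoi_sum _ fun l _ => ?_
    rcases (hA.eigenvalues_nonneg k).eq_or_lt' with hk | hk
    · simpa [eigRepr_eq_zero_left hA.isHermitian hR hker hk] using hasIntegralIoi_zero
    rcases (hA.eigenvalues_nonneg l).eq_or_lt' with hl | hl
    · simpa [eigRepr_eq_zero_right hA.isHermitian hker hl] using hasIntegralIoi_zero
    exact (hasIntegralIoi_kerT hk hl).const_mul _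
  rw [logDeriv, trPair_eigHadamard]
  simp only [mul_comm (kerT _ _)]
  refine h.congr fun u hu => ?_
  rw [inv_add_smul_one_eq_cfc hA hu, cfc_mul_mul_cfc hA.isHermitian, trPair_eigHadamard]
  simp only [mul_comm]

/-- `Tr R log A = ∫ Tr R ((1 + u)⁻¹ - (A + u)⁻¹) du`. -/
lemma hasIntegralIoi_log {A R : Matrix m m ℂ} (hA : A.PosSemidef)
    (hker : ∀ v : m → ℂ, A *ᵥ v = 0 → R *ᵥ v = 0) :
    HasIntegralIoi (fun u => (1 + u)⁻¹ * trPair R 1 -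
      trPair R (A + u • (1 : Matrix m m ℂ))⁻¹) (trPair R (cfc Real.log A)) := by
  have h : HasIntegralIoi (fun u => ∑ k, ((1 + u)⁻¹ - (hA.isHermitian.eigenvalues k + u)⁻¹) *
      (eigRepr hA.isHermitian R k k).re) (∑ k, Real.log (hA.isHermitian.eigenvalues k) *
      (eigRepr hA.isHermitian R k k).re) := by
    refine hasIntegralIoi_sum _ fun k _ => ?_
    rcases (hA.eigenvalues_nonneg k).eq_or_lt' with hk | hk
    · simpa [eigRepr_eq_zero_right hA.isHermitian hker hk] using hasIntegralIoi_zero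
    rw [← sub_one_mul_kerT hk, mul_comm (_ - _), mul_assoc, mul_comm _ (Complex.re _), mul_comm,
      mul_assoc]
    refine ((hasIntegralIoi_kerT one_pos hk).const_mul _).const_mul _ |>.congr fun u hu => ?_
    have h1 : 1 + u ≠ 0 := by positivity
    have h2 : hA.isHermitian.eigenvalues k + u ≠ 0 := by positivity
    field_simp
    ring
  rw [trPair_cfc hA.isHermitian]
  refine h.congr fun u hu => ?_
  have h1 : (1 : Matrix m m ℂ) = cfc (fun _ : ℝ => (1 : ℝ)) A :=
    (cfc_const_one ℝ A (ha := hA.isHermitian.isSelfAdjoint)).symm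
  rw [inv_add_smul_one_eq_cfc hA hu, h1, trPair_cfc hA.isHermitian, trPair_cfc hA.isHermitian,
    Finset.mul_sum, ← Finset.sum_sub_distrib]
  refine Finset.sum_congr rfl fun k _ => ?_
  ring

/-- Operator convexity of the inverse, in gradient form: `B⁻¹ ≥ A⁻¹ - A⁻¹ (B - A) A⁻¹`. The
difference is `(B⁻¹ - A⁻¹) B (B⁻¹ - A⁻¹)`. -/
lemma posSemidef_inv_sub_inv_add {A B : Matrix m m ℂ} (hA : A.PosDef) (hB : B.PosDef) :
    (B⁻¹ - A⁻¹ + A⁻¹ * (B - A) * A⁻¹).PosSemidef := by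
  have hAu := (Matrix.isUnit_iff_isUnit_det _).1 hA.isUnit
  have hBu := (Matrix.isUnit_iff_isUnit_det _).1 hB.isUnit
  have h := hB.posSemidef.mul_mul_conjTranspose_same (B⁻¹ - A⁻¹)
  rw [(hB.inv.isHermitian.sub hA.inv.isHermitian).eq] at h
  convert h using 1
  simp only [sub_mul, mul_sub, Matrix.nonsing_inv_mul _ hAu, Matrix.nonsing_inv_mul _ hBu, one_mul,
    mul_assoc, Matrix.mul_nonsing_inv _ hBu, mul_one]
  abel

/-- Concavity of the logarithm in gradient form: for `R ≥ 0` whose kernel contains those of `A`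
and `B`, the function `Tr R log` lies below its tangent at `A`. -/
lemma trPair_log_sub_le {A B R : Matrix m m ℂ} (hA : A.PosSemidef) (hB : B.PosSemidef)
    (hR : R.PosSemidef) (hkA : ∀ v : m → ℂ, A *ᵥ v = 0 → R *ᵥ v = 0)
    (hkB : ∀ v : m → ℂ, B *ᵥ v = 0 → R *ᵥ v = 0) :
    trPair R (cfc Real.log B) - trPair R (cfc Real.log A) ≤
      trPair (logDeriv hA.isHermitian R) (B - A) := by
  refine ((hasIntegralIoi_log hB hkB).sub (hasIntegralIoi_log hA hkA)).mono
    (hasIntegralIoi_logDeriv hA hR.isHermitian hkA (B - A)) fun u hu => ?_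
  have h := trPair_nonneg hR
    (posSemidef_inv_sub_inv_add (posDef_add_smul_one hA hu) (posDef_add_smul_one hB hu))
  rw [add_sub_add_right_eq_sub, trPair_add_right, trPair_sub_right] at h
  have h2 : ∀ Q : Matrix m m ℂ, trPair (Q * R * Q) (B - A) = trPair R (Q * (B - A) * Q) := by
    intro Q
    rw [trPair, trPair, mul_assoc Q, mul_assoc Q, Matrix.trace_mul_comm Q]
    simp only [mul_assoc]
  rw [h2]
  linarith

/-- `Tr L_A(R) A = Tr R`. -/
lemma trPair_logDeriv_self {A R : Matrix m m ℂ} (hA : A.PosSemidef)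
    (hker : ∀ v : m → ℂ, A *ᵥ v = 0 → R *ᵥ v = 0) :
    trPair (logDeriv hA.isHermitian R) A = R.trace.re := by
  rw [logDeriv, trPair_eigHadamard, eigRepr_self, ← trace_eigRepr hA.isHermitian, Matrix.trace,
    Complex.re_sum]
  refine Finset.sum_congr rfl fun k _ => ?_
  rw [Finset.sum_eq_single k _ (by simp)]
  · rcases (hA.eigenvalues_nonneg k).eq_or_lt' with hk | hk
    · simp [eigRepr_eq_zero_right hA.isHermitian hker hk]
    · rw [Matrix.diagonal_apply_eq, mul_comm (eigRepr _ _ _ _), Complex.re_ofReal_mul,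
        kerT_self hk, inv_mul_cancel_left₀ hk.ne', Matrix.diag_apply]
  · intro l _ hl
    simp [Matrix.diagonal_apply_ne _ hl]

/-- A Fatou bound for `L_A(R)` as `A` degenerates: an upper bound on `Tr L_A(R) X`, `X ≥ 0`,
passes to limits of `A`, even though `L` is not continuous where the rank drops. -/
lemma trPair_logDeriv_le_of_tendsto {A R X : Matrix m m ℂ} {B : ℕ → Matrix m m ℂ} {c : ℝ}
    (hA : A.PosSemidef) (hB : ∀ n, (B n).PosSemidef) (hR : R.PosSemidef) (hX : X.PosSemidef)
    (hkA : ∀ v : m → ℂ, A *ᵥ v = 0 → R *ᵥ v = 0)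
    (hkB : ∀ n, ∀ v : m → ℂ, B n *ᵥ v = 0 → R *ᵥ v = 0) (hlim : Tendsto B atTop (𝓝 A))
    (hc : ∀ n, trPair (logDeriv (hB n).isHermitian R) X ≤ c) :
    trPair (logDeriv hA.isHermitian R) X ≤ c := by
  have hnn : ∀ {A : Matrix m m ℂ}, A.PosSemidef → ∀ u : ℝ, 0 < u →
      0 ≤ trPair ((A + u • (1 : Matrix m m ℂ))⁻¹ * R * (A + u • (1 : Matrix m m ℂ))⁻¹) X := by
    intro A hA u hu
    refine trPair_nonneg ?_ hX
    have h := hR.mul_mul_conjTranspose_same (A + u • (1 : Matrix m m ℂ))⁻¹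
    rwa [(posDef_add_smul_one hA hu).inv.isHermitian.eq] at h
  have hval : ∀ {A : Matrix m m ℂ} (hA : A.PosSemidef) (_ : ∀ v : m → ℂ, A *ᵥ v = 0 → R *ᵥ v = 0),
      ∫⁻ u in Set.Ioi (0 : ℝ), ENNReal.ofReal (trPair ((A + u • (1 : Matrix m m ℂ))⁻¹ * R *
        (A + u • (1 : Matrix m m ℂ))⁻¹) X) =
        ENNReal.ofReal (trPair (logDeriv hA.isHermitian R) X) := by
    intro A hA hk
    obtain ⟨h1, h2⟩ := hasIntegralIoi_logDeriv hA hR.isHermitian hk X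
    rw [← h2, ofReal_integral_eq_lintegral_ofReal h1]
    filter_upwards [ae_restrict_mem measurableSet_Ioi] with u hu using hnn hA u hu
  have hpt : ∀ u : ℝ, 0 < u → Tendsto (fun n => ENNReal.ofReal (trPair
      ((B n + u • (1 : Matrix m m ℂ))⁻¹ * R * (B n + u • (1 : Matrix m m ℂ))⁻¹) X)) atTop
      (𝓝 (ENNReal.ofReal (trPair ((A + u • (1 : Matrix m m ℂ))⁻¹ * R *
        (A + u • (1 : Matrix m m ℂ))⁻¹) X))) := by
    intro u hu
    have h1 : Tendsto (fun n => (B n + u • (1 : Matrix m m ℂ))⁻¹) atTop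
        (𝓝 (A + u • (1 : Matrix m m ℂ))⁻¹) := by
      have hd : (A + u • (1 : Matrix m m ℂ)).det ≠ 0 := (posDef_add_smul_one hA hu).det_pos.ne'
      refine (continuousAt_matrix_inv _ ?_).tendsto.comp (hlim.add_const _)
      rw [Ring.inverse_eq_inv']
      exact continuousAt_inv₀ hd
    refine (ENNReal.continuous_ofReal.tendsto _).comp ?_
    exact ((continuous_trPair_left X).tendsto _).comp ((h1.mul_const R).mul h1)
  have hc0 : 0 ≤ c := by
    obtain ⟨h1, h2⟩ := hasIntegralIoi_logDeriv (hB 0) hR.isHermitian (hkB 0) X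
    refine le_trans ?_ (hc 0)
    rw [← h2]
    exact setIntegral_nonneg measurableSet_Ioi fun u hu => hnn (hB 0) u hu
  rw [← ENNReal.ofReal_le_ofReal_iff hc0, ← hval hA hkA]
  calc _ = ∫⁻ u in Set.Ioi (0 : ℝ), liminf (fun n => ENNReal.ofReal (trPair
        ((B n + u • (1 : Matrix m m ℂ))⁻¹ * R * (B n + u • (1 : Matrix m m ℂ))⁻¹) X)) atTop :=
        setLIntegral_congr_fun measurableSet_Ioi fun u hu => ((hpt u hu).liminf_eq).symm
    _ ≤ liminf (fun n => ∫⁻ u in Set.Ioi (0 : ℝ), ENNReal.ofReal (trPair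
        ((B n + u • (1 : Matrix m m ℂ))⁻¹ * R * (B n + u • (1 : Matrix m m ℂ))⁻¹) X)) atTop :=
        lintegral_liminf_le' fun n =>
          (hasIntegralIoi_logDeriv (hB n) hR.isHermitian (hkB n) X).1.aemeasurable.ennreal_ofReal
    _ ≤ ENNReal.ofReal c := by
        refine liminf_le_of_le (by isBoundedDefault) fun b hb => ?_
        obtain ⟨n, hn⟩ := hb.exists
        refine hn.trans ?_
        rw [hval (hB n) (hkB n)]
        exact ENNReal.ofReal_le_ofReal (hc n)

end Integral

/-! ### Closest states in a convex set of states -/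

section Support

variable {m : Type*} [Fintype m]

lemma trace_eq_of_re {X : Matrix m m ℂ} (hX : X.IsHermitian) {c : ℝ} (h : X.trace.re = c) :
    X.trace = c := by
  have h2 : star X.trace = X.trace := by rw [← Matrix.trace_conjTranspose, hX.eq]
  rw [← h]
  exact (Complex.conj_eq_iff_re.1 h2).symm

lemma mulVec_eq_zero_of_add_left {A B : Matrix m m ℂ} (hA : A.PosSemidef) (hB : B.PosSemidef)
    {v : m → ℂ} (h : (A + B) *ᵥ v = 0) : A *ᵥ v = 0 := by
  have h1 : star v ⬝ᵥ A *ᵥ v + star v ⬝ᵥ B *ᵥ v = 0 := by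
    rw [← dotProduct_add, ← Matrix.add_mulVec, h, dotProduct_zero]
  rw [← hA.dotProduct_mulVec_zero_iff]
  exact ((add_eq_zero_iff_of_nonneg (hA.dotProduct_mulVec_nonneg v)
    (hB.dotProduct_mulVec_nonneg v)).1 h1).1

lemma isClosed_posSemidef : IsClosed {X : Matrix m m ℂ | X.PosSemidef} := by
  simp only [Matrix.posSemidef_iff_dotProduct_mulVec, Set.ofPred_and, Set.ofPred_forall]
  refine IsClosed.inter ?_ (isClosed_iInter fun v => ?_)
  · exact isClosed_eq (f := fun X : Matrix m m ℂ => Xᴴ) (by fun_prop) continuous_id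
  · exact isClosed_Ici.preimage (f := fun X : Matrix m m ℂ => star v ⬝ᵥ X *ᵥ v) (by fun_prop)

lemma isClosed_isState : IsClosed {X : Matrix m m ℂ | IsState X} :=
  isClosed_posSemidef.inter (isClosed_eq (f := fun X : Matrix m m ℂ => X.trace)
    (by fun_prop) continuous_const)

lemma convex_isState : Convex ℝ {X : Matrix m m ℂ | IsState X} := by
  rintro X ⟨hX, hX1⟩ Y ⟨hY, hY1⟩ a b ha hb hab
  refine ⟨(hX.smul ha).add (hY.smul hb), ?_⟩
  rw [Matrix.trace_add, Matrix.trace_smul, Matrix.trace_smul, hX1, hY1, ← add_smul, hab, one_smul]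

variable [DecidableEq m]

lemma eigHadamard_add {A : Matrix m m ℂ} (hA : A.IsHermitian) (K : ℝ → ℝ → ℝ)
    (X Y : Matrix m m ℂ) :
    eigHadamard hA K (X + Y) = eigHadamard hA K X + eigHadamard hA K Y := by
  simp only [eigHadamard, mul_add, add_mul, Matrix.hadamard_add]

lemma eigHadamard_smul {A : Matrix m m ℂ} (hA : A.IsHermitian) (K : ℝ → ℝ → ℝ) (c : ℝ)
    (X : Matrix m m ℂ) : eigHadamard hA K (c • X) = c • eigHadamard hA K X := by
  simp only [eigHadamard, mul_smul_comm, smul_mul_assoc, Matrix.hadamard_smul]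

lemma trPair_eigHadamard_one {A : Matrix m m ℂ} (hA : A.IsHermitian) (K : ℝ → ℝ → ℝ)
    (X : Matrix m m ℂ) :
    trPair (eigHadamard hA K X) 1 = trPair X (cfc (fun a => K a a) A) := by
  rw [trPair_one_right, ← trace_eigRepr hA, Matrix.trace, Complex.re_sum, trPair_cfc hA]
  simp only [Matrix.diag_apply, eigRepr_eigHadamard, Complex.re_ofReal_mul]

lemma trPair_suppProj_le {A X : Matrix m m ℂ} (hA : A.IsHermitian) (hX : X.PosSemidef) :
    trPair (suppProj A) X ≤ X.trace.re := by
  rw [trPair_comm, suppProj, trPair_cfc hA, ← trace_eigRepr hA, Matrix.trace, Complex.re_sum]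
  refine Finset.sum_le_sum fun k _ => ?_
  have h : 0 ≤ (eigRepr hA X k k).re := by
    have := hX.conjTranspose_mul_mul_same (hA.eigenvectorUnitary : Matrix m m ℂ)
    exact (Complex.le_def.1 (this.diag_nonneg (i := k))).1
  rw [Matrix.diag_apply]
  split_ifs <;> simp [h]

lemma suppProj_mul_mul_suppProj {A X : Matrix m m ℂ} (hA : A.IsHermitian) (hX : X.IsHermitian)
    (hker : ∀ v : m → ℂ, A *ᵥ v = 0 → X *ᵥ v = 0) : suppProj A * X * suppProj A = X := by
  rw [suppProj_sandwich hA]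
  apply eigRepr_injective hA
  ext k l
  rw [eigRepr_eigHadamard]
  by_cases hk : hA.eigenvalues k = 0
  · simp [eigRepr_eq_zero_left hA hX hker hk]
  by_cases hl : hA.eigenvalues l = 0
  · simp [eigRepr_eq_zero_right hA hker hl]
  simp [hk, hl]

lemma logDeriv_self {A : Matrix m m ℂ} (hA : A.PosSemidef) :
    logDeriv hA.isHermitian A = suppProj A := by
  apply eigRepr_injective hA.isHermitian
  ext k l
  rw [logDeriv, eigRepr_eigHadamard, eigRepr_self, suppProj, eigRepr_cfc]
  rcases eq_or_ne k l with rfl | h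
  · rw [Matrix.diagonal_apply_eq, Matrix.diagonal_apply_eq, ← Complex.ofReal_mul]
    rcases (hA.eigenvalues_nonneg k).eq_or_lt' with hk | hk
    · simp [hk]
    · rw [kerT_self hk, inv_mul_cancel₀ hk.ne', if_neg hk.ne']
  · simp [Matrix.diagonal_apply_ne _ h]

lemma exists_posSemidef_smul_one_add {K : Matrix m m ℂ} (hK : K.IsHermitian) :
    ∃ C : ℝ, 0 ≤ C ∧ (C • (1 : Matrix m m ℂ) + K).PosSemidef := by
  refine ⟨∑ i, |hK.eigenvalues i|, by positivity, ?_⟩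
  have h : (∑ i, |hK.eigenvalues i|) • (1 : Matrix m m ℂ) + K =
      cfc (fun x : ℝ => (∑ i, |hK.eigenvalues i|) + x) K := by
    rw [cfc_const_add _ _ _ (ha := hK.isSelfAdjoint), cfc_id' ℝ K (ha := hK.isSelfAdjoint),
      Algebra.algebraMap_eq_smul_one]
  rw [h, cfc_eq_conj hK, Matrix.star_eq_conjTranspose]
  refine (Matrix.PosSemidef.diagonal fun k => ?_).mul_mul_conjTranspose_same _
  rw [Pi.zero_apply, Complex.zero_le_real]
  have h1 := Finset.single_le_sum (f := fun i => |hK.eigenvalues i|) (fun i _ => abs_nonneg _)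
    (Finset.mem_univ k)
  have h2 := neg_abs_le (hK.eigenvalues k)
  linarith

/-- A Hermitian matrix supported on the support of `A ≥ 0` is bounded below by a multiple
of `A`. -/
lemma exists_posSemidef_smul_add {A H : Matrix m m ℂ} (hA : A.PosSemidef) (hH : H.IsHermitian)
    (hker : ∀ v : m → ℂ, A *ᵥ v = 0 → H *ᵥ v = 0) :
    ∃ C : ℝ, 0 ≤ C ∧ (C • A + H).PosSemidef := by
  -- Conjugate by `A^{1/2}`: `H = A^{1/2} K A^{1/2}` with `K` Hermitian, and `C + K ≥ 0`.
  have hK := isHermitian_eigHadamard hA.isHermitian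
    (K := fun a b => (√a)⁻¹ * (√b)⁻¹) (fun a b => mul_comm _ _) hH
  obtain ⟨C, hC, hpos⟩ := exists_posSemidef_smul_one_add hK
  refine ⟨C, hC, ?_⟩
  have hS : (cfc Real.sqrt A).IsHermitian := by
    rw [cfc_eq_conj hA.isHermitian, Matrix.star_eq_conjTranspose]
    refine Matrix.isHermitian_mul_mul_conjTranspose _
      (Matrix.isHermitian_diagonal_of_self_adjoint _ ?_)
    ext k
    simp
  have h := hpos.mul_mul_conjTranspose_same (cfc Real.sqrt A)
  rw [hS.eq, cfc_mul_mul_cfc hA.isHermitian, eigHadamard_add, eigHadamard_smul] at h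
  convert h using 2
  · congr 1
    rw [← cfc_mul_mul_cfc hA.isHermitian, mul_one]
    apply eigRepr_injective hA.isHermitian
    rw [eigRepr_mul, eigRepr_cfc, eigRepr_self, Matrix.diagonal_mul_diagonal]
    congr 1
    ext k
    rw [← Complex.ofReal_mul, Real.mul_self_sqrt (hA.eigenvalues_nonneg k)]
  · apply eigRepr_injective hA.isHermitian
    ext k l
    rw [eigRepr_eigHadamard, eigRepr_eigHadamard]
    rcases (hA.eigenvalues_nonneg k).eq_or_lt' with hk | hk
    · simp [eigRepr_eq_zero_left hA.isHermitian hH hker hk]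
    rcases (hA.eigenvalues_nonneg l).eq_or_lt' with hl | hl
    · simp [eigRepr_eq_zero_right hA.isHermitian hker hl]
    have h1 := (Real.sqrt_pos.2 hk).ne'
    have h2 := (Real.sqrt_pos.2 hl).ne'
    rw [← mul_assoc, ← Complex.ofReal_mul]
    have h3 : √(hA.isHermitian.eigenvalues k) * √(hA.isHermitian.eigenvalues l) *
      ((√(hA.isHermitian.eigenvalues k))⁻¹ * (√(hA.isHermitian.eigenvalues l))⁻¹) = 1 := by
      field_simp
    rw [h3, Complex.ofReal_one, one_mul]

/-- Along `(1 - x) σ + x L_σ^‡(ψ)` the trace is constant, and positivity persists for small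
`x > 0` since `L_σ^‡(ψ)` is supported on the support of `σ`. -/
lemma exists_isXMax {σ ψ : Matrix m m ℂ} (hσh : σ.IsHermitian) (hσ : IsState σ)
    (hψ : ψ.IsHermitian) (hψσ : trPair ψ σ = 1) :
    ∃ xmax : ℝ, IsXMax hσh ψ xmax ∧ 0 < xmax := by
  have hL : (logDerivPinv hσh ψ).IsHermitian :=
    isHermitian_eigHadamard _ kerS_comm hψ
  have htr : (logDerivPinv hσh ψ).trace = 1 := by
    rw [trace_eq_of_re hL (c := 1), Complex.ofReal_one]
    rw [← trPair_one_right, logDerivPinv, trPair_eigHadamard_one, ← hψσ]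
    have h : (fun a => kerS a a) = fun a => a := by
      ext a
      by_cases ha : a = 0 <;> simp [kerS, ha]
    rw [h, cfc_id' ℝ σ (ha := hσh.isSelfAdjoint)]
  have htr2 : ∀ x : ℝ, (segState hσh ψ x).trace = 1 := by
    intro x
    rw [segState, Matrix.trace_add, Matrix.trace_smul, Matrix.trace_smul, hσ.2, htr, ← add_smul,
      sub_add_cancel, one_smul]
  obtain ⟨C, hC, hpos⟩ := exists_posSemidef_smul_add hσ.1 hL
    (eigHadamard_mulVec_eq_zero hσh kerS_zero_right ψ)
  set x₀ : ℝ := (1 + C)⁻¹ with hx₀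
  have hx₀pos : 0 < x₀ := by positivity
  have hx₀le : x₀ ≤ 1 := inv_le_one_of_one_le₀ (by linarith)
  have hmem : IsState (segState hσh ψ x₀) := by
    refine ⟨?_, htr2 _⟩
    have h : segState hσh ψ x₀ = x₀ • (C • σ + logDerivPinv hσh ψ) := by
      rw [segState, smul_add, smul_smul]
      congr 2
      rw [hx₀]
      field_simp
      ring
    rw [h]
    exact hpos.smul hx₀pos.le
  have hcl : IsClosed {x : ℝ | IsState (segState hσh ψ x)} :=
    isClosed_isState.preimage (f := fun x : ℝ => segState hσh ψ x) (by
      unfold segState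
      fun_prop)
  obtain ⟨x, ⟨hx1, hx2⟩, hmax⟩ := ((isCompact_Icc (a := x₀) (b := (1 : ℝ))).inter_right
    hcl).exists_isGreatest ⟨x₀, ⟨le_rfl, hx₀le⟩, hmem⟩
  refine ⟨x, ⟨⟨hx1.2, hx2⟩, fun y hy => ?_⟩, hx₀pos.trans_le hx1.1⟩
  rcases le_total x₀ y with h | h
  · exact hmax ⟨⟨h, hy.1⟩, hy.2⟩
  · exact h.trans hx1.1

lemma relEntropy_of_ker_le {ρ σ : Matrix m m ℂ} (h : ∀ v : m → ℂ, σ *ᵥ v = 0 → ρ *ᵥ v = 0) :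
    relEntropy ρ σ =
      ((trPair ρ (cfc Real.log ρ) - trPair ρ (cfc Real.log σ) : ℝ) : EReal) := if_pos h

lemma relEntropy_of_not_ker_le {ρ σ : Matrix m m ℂ}
    (h : ¬ ∀ v : m → ℂ, σ *ᵥ v = 0 → ρ *ᵥ v = 0) : relEntropy ρ σ = ⊤ := if_neg h

/-- If `L_σ(ρ)` attains its maximum `1` over `D` at `σ`, then `σ` is closest to `ρ`. -/
lemma isClosestState_of_forall_trPair_le {D : Set (Matrix m m ℂ)} (hst : ∀ τ ∈ D, IsState τ)
    {σ ρ : Matrix m m ℂ} (hσD : σ ∈ D) (hσ : σ.PosSemidef) (hρ : IsState ρ)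
    (hker : ∀ v : m → ℂ, σ *ᵥ v = 0 → ρ *ᵥ v = 0)
    (hle : ∀ τ ∈ D, trPair (logDeriv hσ.isHermitian ρ) τ ≤ 1) : IsClosestState D ρ σ := by
  refine ⟨hσD, le_antisymm (iInf₂_le σ hσD) (le_iInf₂ fun τ hτ => ?_)⟩
  by_cases hk : ∀ v : m → ℂ, τ *ᵥ v = 0 → ρ *ᵥ v = 0
  · rw [relEntropy_of_ker_le hk, relEntropy_of_ker_le hker, EReal.coe_le_coe_iff]
    have h := trPair_log_sub_le hσ (hst τ hτ).1 hρ.1 hker hk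
    rw [trPair_sub_right, trPair_logDeriv_self hσ hker, hρ.2, Complex.one_re] at h
    linarith [hle τ hτ]
  · rw [relEntropy_of_not_ker_le hk]
    exact le_top

lemma IsClosestState.ker_le {D : Set (Matrix m m ℂ)} (hmix : ∃ τ ∈ D, τ.PosDef)
    {σ ρ : Matrix m m ℂ} (h : IsClosestState D ρ σ) :
    ∀ v : m → ℂ, σ *ᵥ v = 0 → ρ *ᵥ v = 0 := by
  by_contra hk
  obtain ⟨τ, hτ, hpd⟩ := hmix
  have h1 : relEntropy ρ σ ≤ relEntropy ρ τ := h.2 ▸ iInf₂_le τ hτ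
  have h2 : ∀ v : m → ℂ, τ *ᵥ v = 0 → ρ *ᵥ v = 0 := by
    intro v hv
    rw [Matrix.eq_zero_of_mulVec_eq_zero hpd.det_pos.ne' hv, Matrix.mulVec_zero]
  rw [relEntropy_of_not_ker_le hk, relEntropy_of_ker_le h2, top_le_iff] at h1
  exact EReal.coe_ne_top _ h1

/-- First-order optimality at a closest state `σ`. The gradient inequality is used at the points
`(1 - t) σ + t τ`, and the resulting bound is carried to `t → 0` by Fatou's lemma. -/
lemma IsClosestState.trPair_logDeriv_le {D : Set (Matrix m m ℂ)} (hconv : Convex ℝ D)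
    (hst : ∀ τ ∈ D, IsState τ) {σ ρ : Matrix m m ℂ} (hσ : σ.PosSemidef) (hρ : IsState ρ)
    (hker : ∀ v : m → ℂ, σ *ᵥ v = 0 → ρ *ᵥ v = 0) (h : IsClosestState D ρ σ)
    {τ : Matrix m m ℂ} (hτ : τ ∈ D) : trPair (logDeriv hσ.isHermitian ρ) τ ≤ 1 := by
  have hτp := (hst τ hτ).1
  -- The parameters `t n = 1 / (n + 2)` lie strictly between `0` and `1`.
  have ht : ∀ n : ℕ, (0 : ℝ) < 1 / ((n + 1 : ℕ) + 1 : ℝ) ∧ 1 / ((n + 1 : ℕ) + 1 : ℝ) < 1 := by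
    intro n
    refine ⟨by positivity, ?_⟩
    rw [div_lt_one (by positivity)]
    push_cast
    have : (0 : ℝ) ≤ n := n.cast_nonneg
    linarith
  set t : ℕ → ℝ := fun n => 1 / ((n + 1 : ℕ) + 1 : ℝ) with ht_def
  have htlim : Tendsto t atTop (𝓝 0) :=
    (tendsto_one_div_add_atTop_nhds_zero_nat (𝕜 := ℝ)).comp (tendsto_add_atTop_nat 1)
  set B : ℕ → Matrix m m ℂ := fun n => (1 - t n) • σ + t n • τ with hB_def
  have ht0 : ∀ n, 0 < t n := fun n => (ht n).1
  have ht1 : ∀ n, 0 < 1 - t n := fun n => sub_pos.2 (ht n).2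
  have hBp : ∀ n, (B n).PosSemidef := fun n => (hσ.smul (ht1 n).le).add (hτp.smul (ht0 n).le)
  have hBD : ∀ n, B n ∈ D := fun n => hconv h.1 hτ (ht1 n).le (ht0 n).le (by ring)
  have hBker : ∀ n, ∀ v : m → ℂ, B n *ᵥ v = 0 → ρ *ᵥ v = 0 := by
    intro n v hv
    have h1 := mulVec_eq_zero_of_add_left (hσ.smul (ht1 n).le) (hτp.smul (ht0 n).le) hv
    rw [Matrix.smul_mulVec, smul_eq_zero] at h1
    exact hker v (h1.resolve_left (ht1 n).ne')
  have hBlim : Tendsto B atTop (𝓝 σ) := by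
    have h1 := ((htlim.const_sub 1).smul_const σ).add (htlim.smul_const τ)
    simpa using h1
  refine trPair_logDeriv_le_of_tendsto hσ hBp hρ.1 hτp hker hBker hBlim fun n => ?_
  have h1 : relEntropy ρ σ ≤ relEntropy ρ (B n) := h.2 ▸ iInf₂_le (B n) (hBD n)
  rw [relEntropy_of_ker_le hker, relEntropy_of_ker_le (hBker n), EReal.coe_le_coe_iff] at h1
  have h2 := trPair_log_sub_le (hBp n) hσ hρ.1 (hBker n) hker
  have h3 := trPair_logDeriv_self (hBp n) (hBker n)
  rw [hρ.2, Complex.one_re] at h3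
  rw [trPair_sub_right, h3] at h2
  have h4 : (1 - t n) * trPair (logDeriv (hBp n).isHermitian ρ) σ +
      t n * trPair (logDeriv (hBp n).isHermitian ρ) τ = 1 := by
    rw [← trPair_smul_right, ← trPair_smul_right, ← trPair_add_right]
    exact h3
  have h5 : 1 ≤ trPair (logDeriv (hBp n).isHermitian ρ) σ := by linarith
  by_contra! h6
  nlinarith [ht0 n, ht1 n]

/-- The criterion for closest states in a convex set of states containing a state of full rank. -/
theorem isClosestState_iff {D : Set (Matrix m m ℂ)} (hconv : Convex ℝ D)
    (hst : ∀ τ ∈ D, IsState τ) (hmix : ∃ τ ∈ D, τ.PosDef) {σ ρ : Matrix m m ℂ} (hσD : σ ∈ D)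
    (hσ : σ.IsHermitian) (hρ : IsState ρ) (hρD : ρ ∉ D) :
    IsClosestState D ρ σ ↔ ∃ (ψ : Matrix m m ℂ) (xmax x : ℝ),
      IsSupporting D σ ψ ∧ IsXMax hσ ψ xmax ∧ 0 < x ∧ x ≤ xmax ∧ ρ = segState hσ ψ x := by
  have hσp := (hst σ hσD).1
  constructor
  · intro h
    have hker := h.ker_le hmix
    have hself : trPair (logDeriv hσ ρ) σ = 1 := by
      rw [trPair_logDeriv_self hσp hker, hρ.2, Complex.one_re]
    have hpinv : logDerivPinv hσ (logDeriv hσ ρ) = ρ := by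
      rw [logDerivPinv_logDeriv hσp, suppProj_mul_mul_suppProj hσ hρ.1.isHermitian hker]
    have hseg : segState hσ (logDeriv hσ ρ) 1 = ρ := by
      rw [segState, sub_self, zero_smul, zero_add, one_smul, hpinv]
    refine ⟨logDeriv hσ ρ, 1, 1, ⟨?_, ?_, hself, ?_, ?_⟩, ⟨⟨le_rfl, ?_⟩, fun y hy => hy.1⟩,
      one_pos, le_rfl, hseg.symm⟩
    · exact isHermitian_eigHadamard _ kerT_comm hρ.1.isHermitian
    · intro τ hτ
      rw [hself]
      exact h.trPair_logDeriv_le hconv hst hσp hρ hker hτ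
    · exact eigHadamard_mulVec_eq_zero hσ kerT_zero_right ρ
    · -- `L_σ(ρ) = P_σ = L_σ(σ)` would force `ρ = σ ∈ D`.
      intro heq
      apply hρD
      rw [← hpinv, heq, ← logDeriv_self hσp, logDerivPinv_logDeriv hσp,
        suppProj_mul_mul_suppProj hσ hσ fun _ hv => hv]
      exact hσD
    · rw [hseg]
      exact hρ
  · rintro ⟨ψ, xmax, x, hψ, hmax, hx0, hx, rfl⟩
    have hx1 : x ≤ 1 := hx.trans hmax.1.1
    have hker : ∀ v : m → ℂ, σ *ᵥ v = 0 → segState hσ ψ x *ᵥ v = 0 := by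
      intro v hv
      rw [segState, Matrix.add_mulVec, Matrix.smul_mulVec, Matrix.smul_mulVec, hv,
        logDerivPinv, eigHadamard_mulVec_eq_zero hσ kerS_zero_right ψ v hv, smul_zero, smul_zero,
        add_zero]
    refine isClosestState_of_forall_trPair_le hst hσD hσp hρ hker fun τ hτ => ?_
    have hL : logDeriv hσ (segState hσ ψ x) = (1 - x) • suppProj σ + x • ψ := by
      rw [segState, logDeriv, eigHadamard_add, eigHadamard_smul, eigHadamard_smul, ← logDeriv,
        ← logDeriv, logDeriv_self hσp, logDeriv_logDerivPinv hσp,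
        suppProj_mul_mul_suppProj hσ hψ.isHermitian hψ.vanish]
    rw [hL, trPair_add_left, trPair_smul_left, trPair_smul_left]
    have h1 := trPair_suppProj_le hσ (hst τ hτ).1
    rw [(hst τ hτ).2, Complex.one_re] at h1
    have h2 := hψ.pair_le τ hτ
    rw [hψ.pair_self] at h2
    nlinarith

end Support

/-! ### Compactness of convex hulls and of the set of states -/

section Compactness

/-- By Carathéodory's theorem, the convex hull of a compact set in finite dimension is a finite
union of continuous images of products of simplices and powers of the set. -/
lemma isCompact_convexHull {E : Type*} [AddCommGroup E] [Module ℝ E] [TopologicalSpace E]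
    [ContinuousAdd E] [ContinuousSMul ℝ E] [FiniteDimensional ℝ E] {K : Set E}
    (hK : IsCompact K) : IsCompact (convexHull ℝ K) := by
  have h : convexHull ℝ K = ⋃ k ∈ Finset.range (Module.finrank ℝ E + 2),
      (fun p : (Fin k → ℝ) × (Fin k → E) => ∑ i, p.1 i • p.2 i) ''
        (stdSimplex ℝ (Fin k) ×ˢ Set.pi Set.univ fun _ => K) := by
    ext x
    simp only [Set.mem_iUnion, Set.mem_image, Set.mem_prod, Set.mem_univ_pi, Prod.exists]
    constructor
    · intro hx
      obtain ⟨ι, _, z, w, hz, hind, hw, hw1, rfl⟩ := eq_pos_convex_span_of_mem_convexHull hx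
      let e := Fintype.equivFin ι
      refine ⟨Fintype.card ι, ?_, w ∘ e.symm, z ∘ e.symm, ⟨⟨fun i => (hw _).le, ?_⟩,
        fun i => hz ⟨_, rfl⟩⟩, ?_⟩
      · rw [Finset.mem_range]
        have h1 := hind.card_le_finrank_succ
        have h2 := Submodule.finrank_le (vectorSpan ℝ (Set.range z))
        omega
      · rw [← hw1]
        exact e.symm.sum_comp w
      · exact e.symm.sum_comp fun i => w i • z i
    · rintro ⟨k, -, w, z, ⟨hw, hz⟩, rfl⟩
      exact (convex_convexHull ℝ K).sum_mem (fun i _ => hw.1 i) hw.2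
        fun i _ => subset_convexHull ℝ K (hz i)
  rw [h]
  refine (Finset.range _).isCompact_biUnion fun k _ => ?_
  exact ((isCompact_stdSimplex ℝ (Fin k)).prod (isCompact_univ_pi fun _ => hK)).image
    (by fun_prop)

open scoped MatrixOrder in
lemma isCompact_isState {m : Type*} [Fintype m] : IsCompact {X : Matrix m m ℂ | IsState X} := by
  classical
  have hT : IsCompact (Set.pi Set.univ fun _ => Set.pi Set.univ fun _ =>
      Metric.closedBall 0 1 : Set (m → m → ℂ)) :=
    isCompact_univ_pi fun _ => isCompact_univ_pi fun _ => isCompact_closedBall (0 : ℂ) 1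
  refine (hT.image (f := fun B : Matrix m m ℂ => star B * B) (by fun_prop)).of_isClosed_subset
    isClosed_isState ?_
  rintro X ⟨hX, hX1⟩
  obtain ⟨B, rfl⟩ := CStarAlgebra.nonneg_iff_eq_star_mul_self.mp hX.nonneg
  refine ⟨B, fun i _ j _ => ?_, rfl⟩
  have h : ∑ j, ∑ i, ‖B i j‖ ^ 2 = 1 := by
    have h1 := congrArg Complex.re hX1
    rw [Matrix.trace, Complex.re_sum, Complex.one_re] at h1
    rw [← h1]
    refine Finset.sum_congr rfl fun j _ => ?_
    rw [Matrix.diag_apply, Matrix.mul_apply, Complex.re_sum]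
    refine Finset.sum_congr rfl fun i _ => ?_
    rw [Matrix.star_apply, Complex.star_def, ← Complex.normSq_eq_conj_mul_self, Complex.ofReal_re,
      Complex.normSq_eq_norm_sq]
  have h2 : ‖B i j‖ ^ 2 ≤ 1 := by
    rw [← h]
    exact (Finset.single_le_sum (f := fun i => ‖B i j‖ ^ 2) (fun _ _ => by positivity)
      (Finset.mem_univ i)).trans (Finset.single_le_sum (f := fun j => ∑ i, ‖B i j‖ ^ 2)
        (fun _ _ => by positivity) (Finset.mem_univ j))
  rw [mem_closedBall_zero_iff]
  exact (sq_le_one_iff₀ (norm_nonneg _)).1 h2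

end Compactness

/-! ### Separable and PPT states -/

section Multipartite

variable {s : ℕ} (d : Fin s → ℕ)

lemma tensor_mul (A B : (i : Fin s) → Matrix (Fin (d i)) (Fin (d i)) ℂ) :
    tensor d A * tensor d B = tensor d (fun i => A i * B i) := by
  ext a b
  simp only [tensor, Matrix.mul_apply, Matrix.of_apply, ← Finset.prod_mul_distrib]
  exact (Fintype.prod_sum fun i j => A i (a i) j * B i j (b i)).symm

lemma star_tensor (A : (i : Fin s) → Matrix (Fin (d i)) (Fin (d i)) ℂ) :
    star (tensor d A) = tensor d (fun i => star (A i)) := by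
  ext a b
  simp [tensor, Matrix.star_apply]

lemma trace_tensor (A : (i : Fin s) → Matrix (Fin (d i)) (Fin (d i)) ℂ) :
    (tensor d A).trace = ∏ i, (A i).trace := by
  simp only [tensor, Matrix.trace, Matrix.diag_apply, Matrix.of_apply]
  exact (Fintype.prod_sum fun i j => A i j j).symm

open scoped MatrixOrder in
lemma isState_tensor {A : (i : Fin s) → Matrix (Fin (d i)) (Fin (d i)) ℂ}
    (hA : ∀ i, IsState (A i)) : IsState (tensor d A) := by
  constructor
  · choose B hB using fun i => CStarAlgebra.nonneg_iff_eq_star_mul_self.mp (hA i).1.nonneg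
    rw [funext hB, ← tensor_mul, ← star_tensor]
    exact Matrix.posSemidef_conjTranspose_mul_self _
  · rw [trace_tensor]
    exact Finset.prod_eq_one fun i _ => (hA i).2

lemma isState_of_mem_separableStates {ρ : Matrix (Idx d) (Idx d) ℂ}
    (h : ρ ∈ separableStates d) : IsState ρ := by
  refine convexHull_min ?_ convex_isState h
  rintro _ ⟨A, hA, rfl⟩
  exact isState_tensor d hA

lemma isClosed_separableStates : IsClosed (separableStates d) := by
  refine (isCompact_convexHull ?_).isClosed
  have h : {ρ | ∃ A : (i : Fin s) → Matrix (Fin (d i)) (Fin (d i)) ℂ,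
      (∀ i, IsState (A i)) ∧ ρ = tensor d A} =
      tensor d '' (Set.pi Set.univ fun _ => {X | IsState X}) := by
    ext ρ
    simp [eq_comm]
  rw [h]
  refine (isCompact_univ_pi fun i => isCompact_isState).image ?_
  refine continuous_matrix fun a b => ?_
  simp only [tensor, Matrix.of_apply]
  fun_prop

lemma partialTranspose_add (S : Finset (Fin s)) (X Y : Matrix (Idx d) (Idx d) ℂ) :
    partialTranspose d S (X + Y) = partialTranspose d S X + partialTranspose d S Y := rfl

lemma partialTranspose_smul (S : Finset (Fin s)) (c : ℝ) (X : Matrix (Idx d) (Idx d) ℂ) :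
    partialTranspose d S (c • X) = c • partialTranspose d S X := rfl

lemma partialTranspose_one (S : Finset (Fin s)) :
    partialTranspose d S (1 : Matrix (Idx d) (Idx d) ℂ) = 1 := by
  ext a b
  simp only [partialTranspose, Matrix.of_apply, Matrix.one_apply]
  congr 1
  simp only [funext_iff, eq_iff_iff]
  refine forall_congr' fun i => ?_
  split_ifs
  · exact eq_comm
  · rfl

lemma isClosed_pptStates : IsClosed (pptStates d) := by
  have h : pptStates d = {ρ | IsState ρ} ∩ ⋂ S, {ρ | (partialTranspose d S ρ).PosSemidef} := by
    ext ρ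
    simp [pptStates]
  rw [h]
  refine isClosed_isState.inter (isClosed_iInter fun S => ?_)
  refine isClosed_posSemidef.preimage (f := partialTranspose d S) ?_
  refine continuous_matrix fun a b => ?_
  simp only [partialTranspose, Matrix.of_apply]
  fun_prop

lemma convex_pptStates : Convex ℝ (pptStates d) := by
  rintro X ⟨hX, hX1⟩ Y ⟨hY, hY1⟩ a b ha hb hab
  refine ⟨convex_isState hX hY ha hb hab, fun S => ?_⟩
  rw [partialTranspose_add, partialTranspose_smul, partialTranspose_smul]
  exact ((hX1 S).smul ha).add ((hY1 S).smul hb)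

/-- The maximally mixed state is a product state. -/
lemma exists_smul_one_mem_separableStates [Nonempty (Idx d)] :
    ∃ c : ℝ, 0 < c ∧ c • (1 : Matrix (Idx d) (Idx d) ℂ) ∈ separableStates d := by
  obtain ⟨a₀⟩ := ‹Nonempty (Idx d)›
  have hd : ∀ i, 0 < d i := fun i => (a₀ i).pos
  refine ⟨∏ i, ((d i : ℝ))⁻¹, Finset.prod_pos fun i _ => inv_pos.2 (Nat.cast_pos.2 (hd i)),
    subset_convexHull ℝ _ ⟨fun i => ((d i : ℝ))⁻¹ • 1, fun i => ⟨?_, ?_⟩, ?_⟩⟩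
  · exact Matrix.PosSemidef.one.smul (by positivity)
  · have h : (d i : ℂ) ≠ 0 := Nat.cast_ne_zero.2 (hd i).ne'
    simp [Matrix.trace_smul, h]
  · ext a b
    simp only [tensor, Matrix.of_apply, Matrix.smul_apply, Matrix.one_apply]
    by_cases h : a = b
    · subst h
      simp
    · obtain ⟨i, hi⟩ := Function.ne_iff.1 h
      rw [if_neg h, smul_zero, Finset.prod_eq_zero (Finset.mem_univ i)]
      rw [if_neg hi, smul_zero]

end Multipartite

end REE

theorem theorem7 {s : ℕ} (d : Fin s → ℕ)
    (D : Set (Matrix (REE.Idx d) (REE.Idx d) ℂ))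
    (hD : D = REE.separableStates d ∨ D = REE.pptStates d)
    (σ : Matrix (REE.Idx d) (REE.Idx d) ℂ) (hσ : σ.IsHermitian)
    (hσD : σ ∈ intrinsicFrontier ℝ D) (hσ_sing : σ.det = 0)
    (ρ : Matrix (REE.Idx d) (REE.Idx d) ℂ) (hρ : REE.IsState ρ) (hρD : ρ ∉ D) :
    (REE.IsClosestState D ρ σ ↔
      ∃ (ψ : Matrix (REE.Idx d) (REE.Idx d) ℂ) (xmax x : ℝ),
        REE.IsSupporting D σ ψ ∧ REE.IsXMax hσ ψ xmax ∧ 0 < x ∧ x ≤ xmax ∧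
          ρ = REE.segState hσ ψ x) ∧
    (∀ ψ : Matrix (REE.Idx d) (REE.Idx d) ℂ, REE.IsSupporting D σ ψ →
      ∃ xmax : ℝ, REE.IsXMax hσ ψ xmax ∧ 0 < xmax ∧ xmax ≤ 1) := by
  have hne : Nonempty (REE.Idx d) := by
    by_contra h
    rw [not_nonempty_iff] at h
    exact zero_ne_one (Matrix.trace_eq_zero_of_isEmpty ρ ▸ hρ.2)
  obtain ⟨c, hc, hmem⟩ := REE.exists_smul_one_mem_separableStates d
  have hcD : c • (1 : Matrix (REE.Idx d) (REE.Idx d) ℂ) ∈ D := by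
    rcases hD with rfl | rfl
    · exact hmem
    · refine ⟨REE.isState_of_mem_separableStates d hmem, fun S => ?_⟩
      rw [REE.partialTranspose_smul, REE.partialTranspose_one]
      exact Matrix.PosSemidef.one.smul hc.le
  have hconv : Convex ℝ D := by
    rcases hD with rfl | rfl
    · exact convex_convexHull ℝ _
    · exact REE.convex_pptStates d
  have hclosed : IsClosed D := by
    rcases hD with rfl | rfl
    · exact REE.isClosed_separableStates d
    · exact REE.isClosed_pptStates d
  have hst : ∀ τ ∈ D, REE.IsState τ := by
    rcases hD with rfl | rfl
    · exact fun τ => REE.isState_of_mem_separableStates d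
    · exact fun τ hτ => hτ.1
  have hσD' : σ ∈ D := intrinsicFrontier_subset hclosed hσD
  refine ⟨REE.isClosestState_iff hconv hst ⟨_, hcD, Matrix.PosDef.one.smul hc⟩ hσD' hσ hρ hρD,
    fun ψ hψ => ?_⟩
  obtain ⟨x, hx, hx0⟩ := REE.exists_isXMax hσ (hst σ hσD') hψ.isHermitian hψ.pair_self
  exact ⟨x, hx, hx0, hx.1.1⟩
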